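/- Let $X$ be a finite-dimensional real inner product space with induced norm $\|\cdot\|$, let $C:X\rightrightarrows X$ be a maximal monotone operator with domain $\mathrm{Dom}(C)=\{x:C(x)\neq\emptyset\}$, let $\Omega\subset X$ be a closed convex set, and let $F:\mathrm{Dom}(F)\subset X\to X$ be a map with $\mathrm{Dom}(C)\subset\Omega\subset\mathrm{Dom}(F)$ such that $\langle F(x)-F(x'),x-x'\rangle\ge 0$ for all $x,x'\in\mathrm{Dom}(C)$ and, for some $L>0$, $\|F(x)-F(x')\|\le L\|x-x'\|$ for all $x,x'\in\Omega$. Assume that the solution set $S=\{x: 0\in (F+C)(x)\}$ is nonempty. Let $x_0\in X$, let $d_0$ be the distance of $x_0$ to $S$, and let $\sigma\in(0,1)$, $0<\rho<\bar\rho$, $\bar\varepsilon>0$. Put $\lambda=\sigma/L$, let $P_\Omega$ be the projection onto $\Omega$, let $\log^+ t=\max\{\log t,0\}$ for $t>0$ and $\log^+0=0$, and for $\mu>0$ put $C_\mu(x)=C(x)+\mu(x-x_0)$. For $\mu>0$, the *inner method* with parameter $\mu$ starts from $x_0$, and its $k$-th iteration ($k=1,2,\dots$) consists of the following Tseng modified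 forward-backward splitting step: compute $$y_k=(I+\lambda C_\mu)^{-1}\bigl(x_{k-1}-\lambda F(P_\Omega(x_{k-1}))\bigr),$$ $$b_k=F(y_k)+\tfrac1\lambda(x_{k-1}-y_k)-F(P_\Omega(x_{k-1}))-\mu(y_k-x_0),\qquad \varepsilon_k=0.$$ If $\|b_k+\mu(y_k-x_0)\|\le\rho$ and $\varepsilon_k\le\bar\varepsilon$, it stops and outputs $(y_k,b_k,\varepsilon_k)$; otherwise it sets $x_k=x_{k-1}-\lambda[b_k+\mu(y_k-x_0)]$ and performs the next iteration. The method *DR-HPE*, with its stepsize input $\bar\lambda$ equal to $\lambda$, starts with $$\mathcal D=\frac{2\lambda(\bar\rho-\rho)}{(1-\sigma^2)\bigl(1+1/\sqrt{1-\sigma^2}\bigr)}$$ and repeats the following: call the inner method with $$\mu=\frac{\bar\rho-\rho}{\bigl(1+1/\sqrt{1-\sigma^2}\bigr)\mathcal D}$$ to obtain $(y,b,\varepsilon)$; if $\mu\|y-x_0\|\le\bar\rho-\rho$, stop and output $(y,b)$; otherwise replace $\mathcal D$ by $2\mathcal D$. **Theorem.** For every $M$ there is a constant $K>0$, depending only on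 $M$, such that the following holds for all data as above with $\max\{\sigma^{-1},(1-\sigma)^{-1}\}\le M$. Every step of the inner method is well defined (for every $\mu>0$ and every current iterate in $X$ it has exactly one result), and DR-HPE terminates with a pair $(y,b)$ satisfying $$b\in(F+C)(y),\qquad \|b\|\le\bar\rho,$$ after a total number of inner iterations, summed over all calls of the inner method, of at most $$K\left(1+\frac{Ld_0}{\bar\rho-\rho}\right)\left[1+\log^+\left(\frac{Ld_0}{\rho}\right)\right].$$ -/

import Mathlib

open Real

/-- The data produced by one execution of step 1: a stepsize `lam`, points `y`, `b`
and an error `eps`. -/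
structure StepOutput (X : Type*) where
  lam : ℝ
  y : X
  b : X
  eps : ℝ

section Operators

variable {X : Type*} [NormedAddCommGroup X] [InnerProductSpace ℝ X]

/-- The domain of a set-valued operator `A : X ⇉ X`. -/
def opDom (A : X → Set X) : Set X := {x | (A x).Nonempty}

/-- Monotonicity of a set-valued operator. -/
def IsMonotoneOp (A : X → Set X) : Prop :=
  ∀ x x' v v' : X, v ∈ A x → v' ∈ A x' → 0 ≤ inner ℝ (v - v') (x - x')

/-- Maximal monotonicity: monotone, with no proper monotone extension of the graph. -/
def IsMaximalMonotoneOp (A : X → Set X) : Prop :=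
  IsMonotoneOp A ∧ ∀ B : X → Set X, IsMonotoneOp B → (∀ x, A x ⊆ B x) → A = B

/-- The set-valued operator `(I + lam A)⁻¹`. -/
def resolventOp (lam : ℝ) (A : X → Set X) (x : X) : Set X :=
  {y | ∃ a ∈ A y, y + lam • a = x}

/-- The normal cone operator of a set (the subdifferential of its indicator function). -/
def normalCone (Ω : Set X) (x : X) : Set X :=
  {v | x ∈ Ω ∧ ∀ z ∈ Ω, inner ℝ v (z - x) ≤ 0}

/-- The projection `P_Ω = (I + N_Ω)⁻¹`, as a set-valued operator. -/
def projOp (Ω : Set X) : X → Set X := resolventOp 1 (normalCone Ω)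

/-- The sum `F + C` of a point-to-point map and a set-valued operator. Its value at `x` involves
`F x` only if `x` lies in the domain of `C`. -/
def sumOp (F : X → X) (C : X → Set X) (x : X) : Set X := {b | ∃ c ∈ C x, F x + c = b}

/-- The regularized operator `C_μ(x) = C(x) + μ (x - x₀)`. -/
def regOp (C : X → Set X) (x₀ : X) (μ : ℝ) (x : X) : Set X :=
  {v | ∃ c ∈ C x, c + μ • (x - x₀) = v}

/-- The solution set `B⁻¹(0)` of the inclusion `0 ∈ B x`. -/
def zeroSet (B : X → Set X) : Set X := {x | (0 : X) ∈ B x}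

/-- One step of Tseng's modified forward-backward splitting method, with stepsize `lam`, from the
current iterate `x`, used as an implementation of step 1 of the `μ`-regularized method:
`y = (I + lam C_μ)⁻¹ (x - lam F(P_Ω x))`, `c = (x - y) / lam - F(P_Ω x) - μ (y - x₀)`,
`b = F y + c`, and the error is zero. -/
def TsengStep (F : X → X) (C : X → Set X) (Ω : Set X) (x₀ : X) (lam μ : ℝ) (x : X)
    (s : StepOutput X) : Prop :=
  s.lam = lam ∧ s.eps = 0 ∧
    ∃ p ∈ projOp Ω x,
      s.y ∈ resolventOp lam (regOp C x₀ μ) (x - lam • F p) ∧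
      s.b = F s.y + (lam⁻¹ • (x - s.y) - F p - μ • (s.y - x₀))

/-- `Algorithm2 step1 x₀ μ ρ ε x n r`: the static `μ`-regularized HPE method, with step 1
implemented by `step1`, started from the current iterate `x`, stops after exactly `n`
iterations (executions of step 1) with output `r`. The algorithm itself is started at `x = x₀`. -/
inductive Algorithm2 (step1 : X → StepOutput X → Prop) (x₀ : X) (μ ρ ε : ℝ) :
    X → ℕ → StepOutput X → Prop
  | halt {x : X} {s : StepOutput X} (hs : step1 x s)
      (hb : ‖s.b + μ • (s.y - x₀)‖ ≤ ρ) (he : s.eps ≤ ε) :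
      Algorithm2 step1 x₀ μ ρ ε x 1 s
  | step {x : X} {s r : StepOutput X} {n : ℕ} (hs : step1 x s)
      (hc : ρ < ‖s.b + μ • (s.y - x₀)‖ ∨ ε < s.eps)
      (hr : Algorithm2 step1 x₀ μ ρ ε (x - s.lam • (s.b + μ • (s.y - x₀))) n r) :
      Algorithm2 step1 x₀ μ ρ ε x (n + 1) r

/-- The regularization parameter `μ(D, ρ)`. -/
noncomputable def regParam (σ ρbar ρ D : ℝ) : ℝ :=
  (ρbar - ρ) / ((1 + 1 / √(1 - σ ^ 2)) * D)

/-- The initial guess for the distance to the solution set, in terms of the input `lambar`. -/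
noncomputable def initialGuess (σ lambar ρbar ρ : ℝ) : ℝ :=
  2 * lambar * (ρbar - ρ) / ((1 - σ ^ 2) * (1 + 1 / √(1 - σ ^ 2)))

/-- `DRHPELoop step1 x₀ σ ρbar εbar ρ D n r`: the outer loop of the dynamic regularized HPE
method, entered with the guess `D`, stops with output `r` after exactly `n` inner
iterations, summed over all calls of `Algorithm2`. Here `step1 μ` implements step 1 of
`Algorithm2` for the parameter `μ`. -/
inductive DRHPELoop (step1 : ℝ → X → StepOutput X → Prop) (x₀ : X) (σ ρbar εbar ρ : ℝ) :
    ℝ → ℕ → StepOutput X → Prop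
  | halt {D : ℝ} {n : ℕ} {s : StepOutput X}
      (hs : Algorithm2 (step1 (regParam σ ρbar ρ D)) x₀ (regParam σ ρbar ρ D) ρ εbar x₀ n s)
      (hy : regParam σ ρbar ρ D * ‖s.y - x₀‖ ≤ ρbar - ρ) :
      DRHPELoop step1 x₀ σ ρbar εbar ρ D n s
  | step {D : ℝ} {n m : ℕ} {s r : StepOutput X}
      (hs : Algorithm2 (step1 (regParam σ ρbar ρ D)) x₀ (regParam σ ρbar ρ D) ρ εbar x₀ n s)
      (hy : ρbar - ρ < regParam σ ρbar ρ D * ‖s.y - x₀‖)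
      (hr : DRHPELoop step1 x₀ σ ρbar εbar ρ (2 * D) m r) :
      DRHPELoop step1 x₀ σ ρbar εbar ρ D (n + m) r

/-- `DRHPE step1 x₀ σ lambar ρbar εbar ρ n r`: the dynamic regularized HPE method with input
`(x₀, σ, lambar, (ρbar, εbar), ρ)` stops after exactly `n` inner iterations with output `r`. -/
def DRHPE (step1 : ℝ → X → StepOutput X → Prop) (x₀ : X) (σ lambar ρbar εbar ρ : ℝ)
    (n : ℕ) (r : StepOutput X) : Prop :=
  DRHPELoop step1 x₀ σ ρbar εbar ρ (initialGuess σ lambar ρbar ρ) n r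

end Operators

/-! Put `B = F + C`. For `μ > 0` the inclusion `-μ(u - x₀) ∈ B u` has a solution `u`, and
monotonicity against a nearest zero of `B` gives `‖u - x₀‖ ≤ d₀`. Existence rests on Minty's
theorem, proved here by intersecting balls (`exists_forall_inner_nonpos`,
`IsMonotoneOp.exists_related`), and on `mem_sumOp_of_related`, which needs `F` Lipschitz only on
`Ω`.

Since `λ = σ/L` and projecting onto `Ω` does not increase distances to points of `Ω`, a Tseng step
is an exact-graph HPE step with relative error `σ`. The Fejér inequality `IsHPEStep.fejer` then
yields three facts: the squared distance to `u` contracts by a factor `1 - θ` with `θ ≥ λμ`, the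
residual is `O(‖x - u‖ / λ)`, and `y` stays within `O(d₀)` of `x₀`. So a call with parameter `μ`
costs `O((1 + log⁺(L d₀ / ρ)) / (λμ))` iterations, which is proportional to the guess `D`.

A call can be rejected only if `D < d₀`. As `D` doubles, the costs form a geometric sum of order `D₀
+ d₀`, where `D₀` is the initial guess (`drhpeLoop_complexity`). -/

/-! ### Minty's theorem, resolvents and projections. -/

section Minty

variable {X : Type*} [NormedAddCommGroup X] [InnerProductSpace ℝ X]

/-- The double sum of `t i * t j * ⟪a i - a j, b i - b j⟫` is nonpositive, and it equals twice the
difference of the two sides. -/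
theorem sum_inner_le_inner_sum {ι : Type*} [Fintype ι] (a b : ι → X)
    (h : ∀ i j, inner ℝ (a i - a j) (b i - b j) ≤ 0) {t : ι → ℝ} (ht : t ∈ stdSimplex ℝ ι) :
    ∑ i, t i * inner ℝ (a i) (b i) ≤ inner ℝ (∑ i, t i • a i) (∑ i, t i • b i) := by
  set s := ∑ i, t i * inner ℝ (a i) (b i) with hs
  set A := ∑ i, t i • a i with hA
  set B := ∑ i, t i • b i with hB
  have key : ∀ i, ∑ j, t j * inner ℝ (a i - a j) (b i - b j)
      = inner ℝ (a i) (b i) - inner ℝ (a i) B - inner ℝ A (b i) + s := by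
    intro i
    have h1 : ∀ j, t j * inner ℝ (a i - a j) (b i - b j)
        = t j * inner ℝ (a i) (b i) - inner ℝ (a i) (t j • b j) - inner ℝ (t j • a j) (b i)
          + t j * inner ℝ (a j) (b j) := by
      intro j
      simp only [inner_sub_left, inner_sub_right, real_inner_smul_left, real_inner_smul_right]
      ring
    simp only [h1, Finset.sum_add_distrib, Finset.sum_sub_distrib, ← Finset.sum_mul,
      ← inner_sum, ← sum_inner, ht.2, one_mul, hs, hA, hB]
  have h2 : ∑ i, t i * (∑ j, t j * inner ℝ (a i - a j) (b i - b j)) ≤ 0 :=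
    Finset.sum_nonpos fun i _ => mul_nonpos_of_nonneg_of_nonpos (ht.1 i)
      (Finset.sum_nonpos fun j _ => mul_nonpos_of_nonneg_of_nonpos (ht.1 j) (h i j))
  have h3 : ∑ i, t i * (∑ j, t j * inner ℝ (a i - a j) (b i - b j))
      = s - inner ℝ A B - inner ℝ A B + s := by
    have h1 : ∀ i, t i * (∑ j, t j * inner ℝ (a i - a j) (b i - b j))
        = t i * inner ℝ (a i) (b i) - inner ℝ (t i • a i) B - inner ℝ A (t i • b i) + t i * s := by
      intro i
      rw [key i, real_inner_smul_left, real_inner_smul_right]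
      ring
    simp only [h1, Finset.sum_add_distrib, Finset.sum_sub_distrib, ← Finset.sum_mul,
      ← inner_sum, ← sum_inner, ht.2, one_mul, ← hs, ← hA, ← hB]
  linarith

/-- Balls with diameters `[a i, b i]` have a common point. Minimizing over `y` the maximum of `⟪y -
a i, y - b i⟫` has the concave dual `P t - ‖c t‖ ^ 2` on the simplex; a dual maximizer `t` gives `y
= c t`, and the dual value is nonpositive by the preceding lemma and `⟪A, B⟫ ≤ ‖(A + B) / 2‖ ^ 2`.
-/
theorem exists_forall_inner_nonpos {ι : Type*} [Fintype ι] (a b : ι → X)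
    (h : ∀ i j, inner ℝ (a i - a j) (b i - b j) ≤ 0) :
    ∃ y : X, ∀ i, inner ℝ (y - a i) (y - b i) ≤ 0 := by
  classical
  rcases isEmpty_or_nonempty ι with hι | ⟨⟨i₀⟩⟩
  · exact ⟨0, fun i => isEmptyElim i⟩
  let m : ι → X := fun i => (1 / 2 : ℝ) • (a i + b i)
  let P : (ι → ℝ) → ℝ := fun t => ∑ i, t i * inner ℝ (a i) (b i)
  let c : (ι → ℝ) → X := fun t => ∑ i, t i • m i
  have hcont : Continuous fun t => P t - ‖c t‖ ^ 2 := by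
    simp only [P, c]
    fun_prop
  obtain ⟨t, ht, hmax⟩ := (isCompact_stdSimplex ℝ ι).exists_isMaxOn
    ⟨_, single_mem_stdSimplex ℝ i₀⟩ hcont.continuousOn
  have hneg : P t - ‖c t‖ ^ 2 ≤ 0 := by
    have h1 := sum_inner_le_inner_sum a b h ht
    have h2 : c t = (1 / 2 : ℝ) • (∑ i, t i • a i + ∑ i, t i • b i) := by
      simp only [c, m, ← Finset.sum_add_distrib, Finset.smul_sum, smul_add, smul_smul, mul_comm]
    have h3 : inner ℝ (∑ i, t i • a i) (∑ i, t i • b i) ≤ ‖c t‖ ^ 2 := by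
      rw [h2, norm_smul, mul_pow, norm_add_sq_real]
      have := sq_nonneg ‖(∑ i, t i • a i) - ∑ i, t i • b i‖
      rw [norm_sub_sq_real] at this
      norm_num
      linarith
    exact sub_nonpos.2 (h1.trans h3)
  refine ⟨c t, fun j => le_trans ?_ hneg⟩
  by_contra! hlt
  set δ := inner ℝ (c t - a j) (c t - b j) - (P t - ‖c t‖ ^ 2) with hδ
  have hδ0 : 0 < δ := sub_pos.2 hlt
  set k := ‖c t - m j‖ ^ 2 with hk
  have hk0 : 0 ≤ k := sq_nonneg _
  -- First-order optimality: moving `t` towards the vertex `j` changes the objective by `s * δ - s ^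
  -- 2 * k`, which is positive for small `s` if `δ > 0`.
  have step : ∀ s : ℝ, 0 ≤ s → s ≤ 1 → s * δ ≤ s ^ 2 * k := by
    intro s hs0 hs1
    have hmem : (1 - s) • t + s • Pi.single j (1 : ℝ) ∈ stdSimplex ℝ ι :=
      convex_stdSimplex ℝ ι ht (single_mem_stdSimplex ℝ j) (by linarith) hs0 (by ring)
    have h1 : P ((1 - s) • t + s • Pi.single j (1 : ℝ))
        - ‖c ((1 - s) • t + s • Pi.single j (1 : ℝ))‖ ^ 2 ≤ P t - ‖c t‖ ^ 2 := hmax hmem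
    have hP : P ((1 - s) • t + s • Pi.single j (1 : ℝ))
        = (1 - s) * P t + s * inner ℝ (a j) (b j) := by
      simp [P, add_mul, Finset.sum_add_distrib, Finset.mul_sum, mul_assoc, Pi.single_apply]
    have hc : c ((1 - s) • t + s • Pi.single j (1 : ℝ)) = (1 - s) • c t + s • m j := by
      simp [c, add_smul, Finset.sum_add_distrib, Finset.smul_sum, mul_smul, Pi.single_apply]
    rw [hP, hc, norm_add_sq_real, norm_smul, norm_smul, mul_pow, mul_pow, real_inner_smul_left,
      real_inner_smul_right, Real.norm_eq_abs, Real.norm_eq_abs, sq_abs, sq_abs] at h1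
    have h2 : inner ℝ (c t - a j) (c t - b j)
        = ‖c t‖ ^ 2 - 2 * inner ℝ (c t) (m j) + inner ℝ (a j) (b j) := by
      simp only [m, inner_sub_left, inner_sub_right, real_inner_smul_right, inner_add_right,
        real_inner_self_eq_norm_sq, real_inner_comm (a j) (c t)]
      ring
    rw [hδ, hk, h2, norm_sub_sq_real]
    linarith
  have hδk : 0 < δ + k := by linarith
  have h1 := step (δ / (δ + k)) (by positivity) ((div_le_one hδk).2 (by linarith))
  have h2 : δ / (δ + k) * δ - (δ / (δ + k)) ^ 2 * k = δ ^ 3 / (δ + k) ^ 2 := by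
    field_simp
    ring
  have h3 : 0 < δ ^ 3 / (δ + k) ^ 2 := by positivity
  linarith

theorem isCompact_setOf_inner_nonpos [FiniteDimensional ℝ X] (a b : X) :
    IsCompact {y : X | inner ℝ (y - a) (y - b) ≤ 0} := by
  have := FiniteDimensional.proper ℝ X
  refine (isCompact_closedBall a ‖b - a‖).of_isClosed_subset
    (isClosed_le (by fun_prop) continuous_const) fun y hy => ?_
  rw [Metric.mem_closedBall, dist_eq_norm]
  have h1 : inner ℝ (y - a) (y - b) = ‖y - a‖ ^ 2 - inner ℝ (y - a) (b - a) := by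
    rw [← real_inner_self_eq_norm_sq, ← inner_sub_right, sub_sub_sub_cancel_right]
  have h2 := real_inner_le_norm (y - a) (b - a)
  have h3 : inner ℝ (y - a) (y - b) ≤ 0 := hy
  by_contra! h4
  nlinarith [norm_nonneg (b - a)]

/-- For a monotone operator `A`, every `z` can be written as `y + κ w`, where `(y, w)` is
monotonically related to the graph of `A`. -/
theorem IsMonotoneOp.exists_related [FiniteDimensional ℝ X] {A : X → Set X} (hA : IsMonotoneOp A)
    {κ : ℝ} (hκ : 0 < κ) (z : X) :
    ∃ y w : X, y + κ • w = z ∧ ∀ x, ∀ v ∈ A x, 0 ≤ inner ℝ (w - v) (y - x) := by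
  let G := {p : X × X // p.2 ∈ A p.1}
  let B : G → Set X := fun p => {y | inner ℝ (y - p.1.1) (y - (z - κ • p.1.2)) ≤ 0}
  have hB : (⋂ p, B p).Nonempty := by
    rcases isEmpty_or_nonempty G with hG | ⟨⟨p₀⟩⟩
    · simp
    have hcl : ∀ p, IsClosed (B p) := fun p => (isCompact_setOf_inner_nonpos _ _).isClosed
    -- Finite intersection property: monotonicity gives the sign condition for the endpoints `x` and
    -- `z - κ v`, and `p₀` is added to each finite family to supply a compact ball.
    have h1 := (isCompact_setOf_inner_nonpos p₀.1.1 (z - κ • p₀.1.2)).inter_iInter_nonempty B hcl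
      (fun u => by
        classical
        obtain ⟨y, hy⟩ := exists_forall_inner_nonpos
          (fun i : (insert p₀ u : Finset G) => i.1.1.1)
          (fun i : (insert p₀ u : Finset G) => z - κ • i.1.1.2) (fun i j => by
            have := hA _ _ _ _ i.1.2 j.1.2
            rw [sub_sub_sub_cancel_left, ← smul_sub, real_inner_smul_right, real_inner_comm,
              ← neg_sub, inner_neg_left]
            nlinarith)
        refine ⟨y, hy ⟨p₀, by simp⟩, ?_⟩
        simp only [Set.mem_iInter]
        exact fun i hi => hy ⟨i, by simp [hi]⟩)
    exact h1.mono Set.inter_subset_right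
  obtain ⟨y, hy⟩ := hB
  refine ⟨y, κ⁻¹ • (z - y), by rw [smul_inv_smul₀ hκ.ne']; abel, fun x v hv => ?_⟩
  have h1 : inner ℝ (y - x) (y - (z - κ • v)) ≤ 0 := Set.mem_iInter.1 hy ⟨(x, v), hv⟩
  have h2 : y - (z - κ • v) = -(κ • (κ⁻¹ • (z - y) - v)) := by
    rw [smul_sub, smul_inv_smul₀ hκ.ne']
    abel
  rw [h2, inner_neg_right, real_inner_smul_right, real_inner_comm] at h1
  by_contra! h3
  nlinarith

/-- Adjoining `(y, w)` to the graph keeps it monotone, so maximality forces the pair to be there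
already. -/
theorem IsMaximalMonotoneOp.mem_of_related {A : X → Set X} (hA : IsMaximalMonotoneOp A) {y w : X}
    (h : ∀ x, ∀ v ∈ A x, 0 ≤ inner ℝ (w - v) (y - x)) : w ∈ A y := by
  have h1 : A = fun x => A x ∪ {v | x = y ∧ v = w} := by
    refine hA.2 _ ?_ fun x => Set.subset_union_left
    rintro x x' v v' (hv | ⟨rfl, rfl⟩) (hv' | ⟨rfl, rfl⟩)
    · exact hA.1 _ _ _ _ hv hv'
    · rw [← neg_sub, ← neg_sub x' x, inner_neg_neg]
      exact h _ _ hv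
    · exact h _ _ hv'
    · simp
  rw [h1]
  exact Or.inr ⟨rfl, rfl⟩

/-- Minty's theorem in finite dimension. -/
theorem IsMaximalMonotoneOp.resolventOp_nonempty [FiniteDimensional ℝ X] {A : X → Set X}
    (hA : IsMaximalMonotoneOp A) {κ : ℝ} (hκ : 0 < κ) (z : X) : (resolventOp κ A z).Nonempty := by
  obtain ⟨y, w, hz, h⟩ := hA.1.exists_related hκ z
  exact ⟨y, w, hA.mem_of_related h, hz⟩

theorem IsMonotoneOp.eq_of_mem_resolventOp {A : X → Set X} (hA : IsMonotoneOp A) {κ : ℝ}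
    (hκ : 0 < κ) {z y y' : X} (hy : y ∈ resolventOp κ A z) (hy' : y' ∈ resolventOp κ A z) :
    y = y' := by
  obtain ⟨w, hw, h⟩ := hy
  obtain ⟨w', hw', h'⟩ := hy'
  have h1 := hA _ _ _ _ hw hw'
  have h2 : y - y' = -(κ • (w - w')) := by
    rw [smul_sub]
    linear_combination (norm := module) h - h'
  have h3 : inner ℝ (y - y') (y - y') = -(κ * inner ℝ (w - w') (y - y')) := by
    conv_lhs => rw [h2, inner_neg_left, real_inner_smul_left, ← h2]
  rw [real_inner_self_eq_norm_sq] at h3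
  have h4 : ‖y - y'‖ ^ 2 = 0 := le_antisymm (by nlinarith) (sq_nonneg _)
  exact sub_eq_zero.1 (norm_eq_zero.1 (by simpa using h4))

theorem IsMonotoneOp.regOp {A : X → Set X} (hA : IsMonotoneOp A) (x₀ : X) {μ : ℝ} (hμ : 0 ≤ μ) :
    IsMonotoneOp (regOp A x₀ μ) := by
  rintro x x' _ _ ⟨c, hc, rfl⟩ ⟨c', hc', rfl⟩
  have h1 := hA _ _ _ _ hc hc'
  have h2 : c + μ • (x - x₀) - (c' + μ • (x' - x₀)) = (c - c') + μ • (x - x') := by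
    module
  rw [h2, inner_add_left, real_inner_smul_left, real_inner_self_eq_norm_sq]
  positivity

theorem IsMaximalMonotoneOp.resolventOp_regOp_nonempty [FiniteDimensional ℝ X] {A : X → Set X}
    (hA : IsMaximalMonotoneOp A) (x₀ : X) {μ : ℝ} (hμ : 0 ≤ μ) {κ : ℝ} (hκ : 0 < κ) (z : X) :
    (resolventOp κ (regOp A x₀ μ) z).Nonempty := by
  have h0 : 0 < 1 + κ * μ := by positivity
  -- Dividing `y + κ(c + μ(y - x₀)) = z` by `1 + κμ` turns it into a resolvent equation for `A`
  -- alone.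
  obtain ⟨y, c, hc, h⟩ := hA.resolventOp_nonempty (κ := κ / (1 + κ * μ)) (by positivity)
    ((1 + κ * μ)⁻¹ • (z + (κ * μ) • x₀))
  refine ⟨y, _, ⟨c, hc, rfl⟩, ?_⟩
  have h1 := congrArg (fun x => (1 + κ * μ) • x) h
  simp only [smul_add, smul_smul, mul_div_cancel₀ _ h0.ne', mul_inv_cancel₀ h0.ne',
    mul_inv_cancel_left₀ h0.ne', one_smul] at h1
  linear_combination (norm := module) h1

theorem normalCone_isMonotoneOp (Ω : Set X) : IsMonotoneOp (normalCone Ω) := by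
  rintro x x' v v' ⟨hx, hv⟩ ⟨hx', hv'⟩
  have h1 := hv x' hx'
  have h2 := hv' x hx
  rw [← neg_sub, inner_neg_right] at h1
  rw [inner_sub_left]
  linarith

theorem projOp_nonempty [FiniteDimensional ℝ X] {Ω : Set X} (hcl : IsClosed Ω) (hcv : Convex ℝ Ω)
    (hne : Ω.Nonempty) (x : X) : (projOp Ω x).Nonempty := by
  have := FiniteDimensional.complete ℝ X
  obtain ⟨p, hp, h⟩ := exists_norm_eq_iInf_of_complete_convex hne hcl.isComplete hcv x
  exact ⟨p, x - p, ⟨hp, (norm_eq_iInf_iff_real_inner_le_zero hcv hp).1 h⟩, by simp⟩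

theorem mem_of_mem_projOp {Ω : Set X} {x p : X} (hp : p ∈ projOp Ω x) : p ∈ Ω := by
  obtain ⟨v, hv, -⟩ := hp
  exact hv.1

theorem norm_sub_le_of_mem_projOp {Ω : Set X} {x p y : X} (hp : p ∈ projOp Ω x) (hy : y ∈ Ω) :
    ‖y - p‖ ≤ ‖y - x‖ := by
  obtain ⟨v, ⟨-, hv⟩, rfl⟩ := hp
  have h1 := hv y hy
  have h2 : ‖y - (p + (1 : ℝ) • v)‖ ^ 2 = ‖y - p‖ ^ 2 - 2 * inner ℝ v (y - p) + ‖v‖ ^ 2 := by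
    rw [one_smul, ← sub_sub, norm_sub_sq_real, real_inner_comm]
  exact le_of_sq_le_sq (by nlinarith [sq_nonneg ‖v‖]) (norm_nonneg _)

end Minty

/-! ### The sum `F + C`, its regularized solutions and its zeros. -/

theorem mem_opDom_of_mem_sumOp {X : Type*} [NormedAddCommGroup X] {F : X → X} {C : X → Set X} {x b : X} (h : b ∈ sumOp F C x) :
    x ∈ opDom C := by
  obtain ⟨c, hc, -⟩ := h
  exact ⟨c, hc⟩

section Regularization

variable {X : Type*} [NormedAddCommGroup X] [InnerProductSpace ℝ X]

theorem IsMonotoneOp.sumOp {F : X → X} {C : X → Set X} (hC : IsMonotoneOp C)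
    (hF : ∀ x ∈ opDom C, ∀ x' ∈ opDom C, 0 ≤ inner ℝ (F x - F x') (x - x')) :
    IsMonotoneOp (sumOp F C) := by
  rintro x x' _ _ ⟨c, hc, rfl⟩ ⟨c', hc', rfl⟩
  rw [add_sub_add_comm, inner_add_left]
  exact add_nonneg (hF x ⟨c, hc⟩ x' ⟨c', hc'⟩) (hC _ _ _ _ hc hc')

/-- The sum `F + C` is maximal in the sense that every pair monotonically related to its graph
belongs to it. -/
theorem mem_sumOp_of_related [FiniteDimensional ℝ X] {F : X → X} {C : X → Set X} {Ω : Set X}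
    {L : ℝ} (hcl : IsClosed Ω) (hcv : Convex ℝ Ω) (hdom : opDom C ⊆ Ω) (hL : 0 < L)
    (hLip : ∀ x ∈ Ω, ∀ x' ∈ Ω, ‖F x - F x'‖ ≤ L * ‖x - x'‖) (hC : IsMaximalMonotoneOp C)
    (hne : Ω.Nonempty) {u w : X} (h : ∀ x, ∀ v ∈ sumOp F C x, 0 ≤ inner ℝ (w - v) (u - x)) :
    w ∈ sumOp F C u := by
  obtain ⟨p, hp⟩ := projOp_nonempty hcl hcv hne u
  -- A forward-backward step from `u`. Relatedness gives `2L‖u - y‖² ≤ ⟪F p - F y, u - y⟫ ≤ L‖u -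
  -- y‖²`, hence `y = u`; then `u ∈ Ω` and `p = u`.
  obtain ⟨y, c, hc, hy⟩ := hC.resolventOp_nonempty (κ := (2 * L)⁻¹) (by positivity)
    (u + (2 * L)⁻¹ • (w - F p))
  have hyΩ : y ∈ Ω := hdom ⟨c, hc⟩
  have h1 := h y _ ⟨c, hc, rfl⟩
  have hc' : c = (2 * L) • (u - y) + (w - F p) := by
    have h2 := congrArg (fun x => (2 * L) • x) hy
    have h3 : (2 * L) * (2 * L)⁻¹ = 1 := mul_inv_cancel₀ (by positivity)
    simp only [smul_add, smul_smul, h3, one_smul] at h2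
    linear_combination (norm := module) h2
  have h2 : w - (F y + c) = (F p - F y) - (2 * L) • (u - y) := by
    rw [hc']
    module
  rw [h2, inner_sub_left, real_inner_smul_left, real_inner_self_eq_norm_sq] at h1
  have h3 : inner ℝ (F p - F y) (u - y) ≤ L * ‖u - y‖ ^ 2 := by
    calc inner ℝ (F p - F y) (u - y) ≤ ‖F p - F y‖ * ‖u - y‖ := real_inner_le_norm _ _
      _ ≤ (L * ‖u - y‖) * ‖u - y‖ := by
        gcongr
        refine (hLip p (mem_of_mem_projOp hp) y hyΩ).trans ?_
        rw [norm_sub_rev p y, norm_sub_rev u y]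
        gcongr
        exact norm_sub_le_of_mem_projOp hp hyΩ
      _ = L * ‖u - y‖ ^ 2 := by ring
  have h4 : ‖u - y‖ ^ 2 = 0 := le_antisymm (by nlinarith) (sq_nonneg _)
  have h5 : u = y := sub_eq_zero.1 (norm_eq_zero.1 (by simpa using h4))
  subst h5
  have h6 : u = p := by
    have := norm_sub_le_of_mem_projOp hp hyΩ
    rw [sub_self, norm_zero] at this
    exact sub_eq_zero.1 (norm_le_zero_iff.1 this)
  subst h6
  exact ⟨c, hc, by rw [hc']; module⟩

theorem exists_regularized_zero [FiniteDimensional ℝ X] {F : X → X} {C : X → Set X} {Ω : Set X}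
    {L : ℝ} (hF : ∀ x ∈ opDom C, ∀ x' ∈ opDom C, 0 ≤ inner ℝ (F x - F x') (x - x'))
    (hcl : IsClosed Ω) (hcv : Convex ℝ Ω) (hdom : opDom C ⊆ Ω) (hL : 0 < L)
    (hLip : ∀ x ∈ Ω, ∀ x' ∈ Ω, ‖F x - F x'‖ ≤ L * ‖x - x'‖) (hC : IsMaximalMonotoneOp C)
    (hne : Ω.Nonempty) (x₀ : X) {μ : ℝ} (hμ : 0 < μ) :
    ∃ u : X, -(μ • (u - x₀)) ∈ sumOp F C u := by
  obtain ⟨u, w, hu, h⟩ := (hC.1.sumOp hF).exists_related (inv_pos.2 hμ) x₀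
  refine ⟨u, ?_⟩
  have hw : -(μ • (u - x₀)) = w := by
    rw [← hu, sub_add_cancel_left, smul_neg, neg_neg, smul_inv_smul₀ hμ.ne']
  rw [hw]
  exact mem_sumOp_of_related hcl hcv hdom hL hLip hC hne h

theorem norm_regularized_zero_sub_le {B : X → Set X} (hB : IsMonotoneOp B) {x₀ u z : X} {μ : ℝ}
    (hμ : 0 < μ) (hu : -(μ • (u - x₀)) ∈ B u) (hz : z ∈ zeroSet B) : ‖u - x₀‖ ≤ ‖x₀ - z‖ := by
  have h1 := hB _ _ _ _ hu hz
  rw [sub_zero, inner_neg_left, real_inner_smul_left] at h1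
  have h2 : ‖x₀ - z‖ ^ 2 = ‖u - z‖ ^ 2 - 2 * inner ℝ (u - x₀) (u - z) + ‖u - x₀‖ ^ 2 := by
    rw [show x₀ - z = (u - z) - (u - x₀) by abel, norm_sub_sq_real, real_inner_comm]
  have h3 : inner ℝ (u - x₀) (u - z) ≤ 0 := by
    by_contra! h
    nlinarith
  exact le_of_sq_le_sq (by nlinarith [sq_nonneg ‖u - z‖]) (norm_nonneg _)

theorem isClosed_zeroSet_sumOp {F : X → X} {C : X → Set X} {Ω : Set X} {L : ℝ}
    (hcl : IsClosed Ω) (hdom : opDom C ⊆ Ω)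
    (hLip : ∀ x ∈ Ω, ∀ x' ∈ Ω, ‖F x - F x'‖ ≤ L * ‖x - x'‖) (hC : IsMaximalMonotoneOp C) :
    IsClosed (zeroSet (sumOp F C)) := by
  have hFc : ContinuousOn F Ω := by
    refine (LipschitzOnWith.of_dist_le_mul (K := L.toNNReal) fun x hx y hy => ?_).continuousOn
    rw [dist_eq_norm, dist_eq_norm]
    exact (hLip x hx y hy).trans
      (mul_le_mul_of_nonneg_right (Real.le_coe_toNNReal L) (norm_nonneg _))
  refine isClosed_of_closure_subset fun x hx => ?_
  obtain ⟨xs, hxs, hlim⟩ := mem_closure_iff_seq_limit.1 hx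
  have hxsΩ : ∀ n, xs n ∈ Ω := fun n => hdom (mem_opDom_of_mem_sumOp (hxs n))
  have hxΩ : x ∈ Ω := hcl.mem_of_tendsto hlim (Filter.Eventually.of_forall hxsΩ)
  have hFlim : Filter.Tendsto (fun n => F (xs n)) Filter.atTop (nhds (F x)) :=
    (hFc x hxΩ).tendsto.comp (tendsto_nhdsWithin_iff.2 ⟨hlim, Filter.Eventually.of_forall hxsΩ⟩)
  -- The pairs `(xs n, -F (xs n))` lie in the graph of `C`; monotone relatedness passes to their
  -- limit.
  refine ⟨-F x, hC.mem_of_related fun z v hv => ?_, add_neg_cancel _⟩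
  refine ge_of_tendsto' (((hFlim.neg.sub_const v)).inner (𝕜 := ℝ) (hlim.sub_const z)) fun n => ?_
  obtain ⟨c, hc, hc0⟩ := hxs n
  rw [← eq_neg_of_add_eq_zero_right hc0]
  exact hC.1 _ _ _ _ hc hv

theorem exists_norm_sub_eq_infDist_zeroSet [FiniteDimensional ℝ X] {F : X → X} {C : X → Set X}
    {Ω : Set X} {L : ℝ} (hcl : IsClosed Ω) (hdom : opDom C ⊆ Ω)
    (hLip : ∀ x ∈ Ω, ∀ x' ∈ Ω, ‖F x - F x'‖ ≤ L * ‖x - x'‖) (hC : IsMaximalMonotoneOp C)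
    (hne : (zeroSet (sumOp F C)).Nonempty) (x₀ : X) :
    ∃ z ∈ zeroSet (sumOp F C), ‖x₀ - z‖ = Metric.infDist x₀ (zeroSet (sumOp F C)) := by
  have := FiniteDimensional.proper ℝ X
  obtain ⟨z, hz, h⟩ :=
    (isClosed_zeroSet_sumOp hcl hdom hLip hC).exists_infDist_eq_dist hne x₀
  exact ⟨z, hz, by rw [h, dist_eq_norm]⟩

end Regularization

/-! ### One Tseng step as an HPE step. -/

section Step

variable {X : Type*} [NormedAddCommGroup X] [InnerProductSpace ℝ X]

theorem existsUnique_tsengStep [FiniteDimensional ℝ X] {F : X → X} {C : X → Set X} {Ω : Set X}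
    (hcl : IsClosed Ω) (hcv : Convex ℝ Ω) (hne : Ω.Nonempty) (hC : IsMaximalMonotoneOp C)
    (x₀ : X) {lam μ : ℝ} (hlam : 0 < lam) (hμ : 0 < μ) (x : X) :
    ∃! s : StepOutput X, TsengStep F C Ω x₀ lam μ x s := by
  obtain ⟨p, hp⟩ := projOp_nonempty hcl hcv hne x
  obtain ⟨y, hy⟩ := hC.resolventOp_regOp_nonempty x₀ hμ.le hlam (x - lam • F p)
  refine ⟨⟨lam, y, F y + (lam⁻¹ • (x - y) - F p - μ • (y - x₀)), 0⟩, ⟨rfl, rfl, p, hp, hy, rfl⟩, ?_⟩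
  rintro ⟨lam', y', b', eps'⟩ ⟨h1, h2, p', hp', hy', hb'⟩
  dsimp only at h1 h2 hy' hb'
  obtain rfl : p' = p := (normalCone_isMonotoneOp Ω).eq_of_mem_resolventOp one_pos hp' hp
  obtain rfl : y' = y := (hC.1.regOp x₀ hμ.le).eq_of_mem_resolventOp hlam hy' hy
  rw [h1, h2, hb']

/-- The step output `s` at the current iterate `x` satisfies the relative error criterion of the
hybrid proximal extragradient method with zero error. -/
def IsHPEStep (x₀ : X) (lam σ μ : ℝ) (B : X → Set X) (x : X) (s : StepOutput X) : Prop :=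
  s.lam = lam ∧ s.eps = 0 ∧ s.b ∈ B s.y ∧
    ‖lam • (s.b + μ • (s.y - x₀)) + s.y - x‖ ≤ σ * ‖s.y - x‖

theorem TsengStep.isHPEStep {F : X → X} {C : X → Set X} {Ω : Set X} {L σ μ : ℝ} {x₀ x : X}
    {s : StepOutput X} (hdom : opDom C ⊆ Ω) (hL : 0 < L)
    (hLip : ∀ x ∈ Ω, ∀ x' ∈ Ω, ‖F x - F x'‖ ≤ L * ‖x - x'‖) (hσ : 0 < σ)
    (h : TsengStep F C Ω x₀ (σ / L) μ x s) : IsHPEStep x₀ (σ / L) σ μ (sumOp F C) x s := by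
  obtain ⟨h1, h2, p, hp, ⟨_, ⟨c, hc, rfl⟩, hy⟩, hb⟩ := h
  have hlam : 0 < σ / L := by positivity
  have hyΩ : s.y ∈ Ω := hdom ⟨c, hc⟩
  refine ⟨h1, h2, ⟨c, hc, ?_⟩, ?_⟩
  · have h3 := congrArg (fun x => (σ / L)⁻¹ • x) hy
    simp only [smul_add, smul_sub, smul_smul, inv_mul_cancel₀ hlam.ne', one_smul,
      ← mul_assoc, one_mul] at h3
    rw [hb]
    linear_combination (norm := module) h3
  · have h3 : (σ / L) • (s.b + μ • (s.y - x₀)) + s.y - x = (σ / L) • (F s.y - F p) := by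
      rw [hb]
      simp only [smul_add, smul_sub, smul_smul, mul_inv_cancel₀ hlam.ne', one_smul]
      module
    rw [h3, norm_smul, Real.norm_of_nonneg hlam.le]
    calc σ / L * ‖F s.y - F p‖ ≤ σ / L * (L * ‖s.y - x‖) := by
          gcongr
          refine (hLip _ hyΩ _ (mem_of_mem_projOp hp)).trans ?_
          gcongr
          exact norm_sub_le_of_mem_projOp hp hyΩ
      _ = σ * ‖s.y - x‖ := by field_simp

variable {x₀ x u : X} {lam σ μ : ℝ} {B : X → Set X} {s : StepOutput X}

/-- The regularized operator is `μ`-strongly monotone and vanishes at `u`, which yields the `‖s.y -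
u‖` term; the relative error bound leaves the surplus `(1 - σ ^ 2) * ‖s.y - x‖ ^ 2`. -/
theorem IsHPEStep.fejer (h : IsHPEStep x₀ lam σ μ B x s) (hB : IsMonotoneOp B) (hlam : 0 < lam)
    (hu : -(μ • (u - x₀)) ∈ B u) :
    ‖x - lam • (s.b + μ • (s.y - x₀)) - u‖ ^ 2 + 2 * lam * μ * ‖s.y - u‖ ^ 2
      + (1 - σ ^ 2) * ‖s.y - x‖ ^ 2 ≤ ‖x - u‖ ^ 2 := by
  obtain ⟨-, -, hb, herr⟩ := h
  have h1 := hB _ _ _ _ hb hu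
  set v := s.b + μ • (s.y - x₀) with hv
  have h2 : s.b - -(μ • (u - x₀)) = v - μ • (s.y - u) := by
    rw [hv]
    module
  rw [h2, inner_sub_left, real_inner_smul_left, real_inner_self_eq_norm_sq] at h1
  have h3 : ‖lam • v + s.y - x‖ ^ 2 ≤ σ ^ 2 * ‖s.y - x‖ ^ 2 := by
    rw [← mul_pow]
    gcongr
  have h4 : ‖x - lam • v - u‖ ^ 2
      = ‖x - u‖ ^ 2 - 2 * lam * inner ℝ v (s.y - u) + ‖lam • v + s.y - x‖ ^ 2 - ‖s.y - x‖ ^ 2 := by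
    have e1 : x - lam • v - u = (x - u) - lam • v := by abel
    have e2 : lam • v + s.y - x = lam • v + (s.y - x) := by abel
    have e3 : inner ℝ v (s.y - u) = inner ℝ v (s.y - x) + inner ℝ v (x - u) := by
      rw [← inner_add_right, sub_add_sub_cancel]
    rw [e1, e2, e3, norm_sub_sq_real, norm_add_sq_real, real_inner_smul_left,
      real_inner_smul_right, real_inner_comm]
    ring
  nlinarith

theorem IsHPEStep.contraction (h : IsHPEStep x₀ lam σ μ B x s) (hB : IsMonotoneOp B)
    (hlam : 0 < lam) (hμ : 0 < μ) (hσ : 0 < σ) (hσ1 : σ < 1) (hu : -(μ • (u - x₀)) ∈ B u) :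
    ‖x - lam • (s.b + μ • (s.y - x₀)) - u‖ ^ 2
      ≤ (1 - 2 * lam * μ * (1 - σ ^ 2) / (2 * lam * μ + (1 - σ ^ 2))) * ‖x - u‖ ^ 2 := by
  have h1 := h.fejer hB hlam hu
  have hQ : 0 < 1 - σ ^ 2 := by nlinarith
  have hP : 0 < 2 * lam * μ := by positivity
  set P := 2 * lam * μ
  set Q := 1 - σ ^ 2
  have h2 : ‖x - u‖ ≤ ‖s.y - u‖ + ‖s.y - x‖ := by
    rw [norm_sub_rev s.y x, add_comm]
    exact norm_sub_le_norm_sub_add_norm_sub _ _ _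
  -- Both gains in the Fejér inequality are spent on `‖x - u‖` through weighted Cauchy–Schwarz.
  have h3 : P * Q / (P + Q) * ‖x - u‖ ^ 2 ≤ P * ‖s.y - u‖ ^ 2 + Q * ‖s.y - x‖ ^ 2 := by
    calc P * Q / (P + Q) * ‖x - u‖ ^ 2
        ≤ P * Q / (P + Q) * (‖s.y - u‖ + ‖s.y - x‖) ^ 2 := by gcongr
      _ ≤ P * ‖s.y - u‖ ^ 2 + Q * ‖s.y - x‖ ^ 2 := by
        rw [div_mul_eq_mul_div, div_le_iff₀ (by positivity)]
        nlinarith [sq_nonneg (P * ‖s.y - u‖ - Q * ‖s.y - x‖)]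
  linarith

theorem IsHPEStep.norm_residual_le (h : IsHPEStep x₀ lam σ μ B x s) (hB : IsMonotoneOp B)
    (hlam : 0 < lam) (hμ : 0 < μ) (hσ : 0 < σ) (hσ1 : σ < 1) (hu : -(μ • (u - x₀)) ∈ B u) :
    ‖s.b + μ • (s.y - x₀)‖ ≤ (1 + σ) / (lam * √(1 - σ ^ 2)) * ‖x - u‖ := by
  have h1 := h.fejer hB hlam hu
  have hQ : 0 < 1 - σ ^ 2 := by nlinarith
  have hR : 0 < √(1 - σ ^ 2) := Real.sqrt_pos.2 hQ
  obtain ⟨-, -, -, herr⟩ := h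
  have h2 : √(1 - σ ^ 2) * ‖s.y - x‖ ≤ ‖x - u‖ := by
    refine le_of_sq_le_sq ?_ (norm_nonneg _)
    rw [mul_pow, Real.sq_sqrt hQ.le]
    have : 0 ≤ 2 * lam * μ * ‖s.y - u‖ ^ 2 := by positivity
    nlinarith [sq_nonneg ‖x - lam • (s.b + μ • (s.y - x₀)) - u‖]
  have h3 : lam * ‖s.b + μ • (s.y - x₀)‖ ≤ (1 + σ) * ‖s.y - x‖ := by
    have h5 : lam * ‖s.b + μ • (s.y - x₀)‖ = ‖lam • (s.b + μ • (s.y - x₀))‖ := by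
      rw [norm_smul, Real.norm_of_nonneg hlam.le]
    have h4 := norm_sub_le (lam • (s.b + μ • (s.y - x₀)) + s.y - x) (s.y - x)
    rw [add_sub_assoc, add_sub_cancel_right, ← add_sub_assoc] at h4
    linarith
  rw [div_mul_eq_mul_div, le_div_iff₀ (by positivity)]
  calc ‖s.b + μ • (s.y - x₀)‖ * (lam * √(1 - σ ^ 2))
      = √(1 - σ ^ 2) * (lam * ‖s.b + μ • (s.y - x₀)‖) := by ring
    _ ≤ √(1 - σ ^ 2) * ((1 + σ) * ‖s.y - x‖) := by gcongr
    _ = (1 + σ) * (√(1 - σ ^ 2) * ‖s.y - x‖) := by ring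
    _ ≤ (1 + σ) * ‖x - u‖ := by gcongr

theorem IsHPEStep.norm_sub_le (h : IsHPEStep x₀ lam σ μ B x s) (hB : IsMonotoneOp B)
    (hlam : 0 < lam) (hμ : 0 < μ) (hσ : 0 < σ) (hσ1 : σ < 1) (hu : -(μ • (u - x₀)) ∈ B u) :
    ‖s.y - u‖ ≤ 1 / √(1 - σ ^ 2) * ‖x - u‖ := by
  have h1 := h.fejer hB hlam hu
  have hQ : 0 < 1 - σ ^ 2 := by nlinarith
  have hR : 0 < √(1 - σ ^ 2) := Real.sqrt_pos.2 hQ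
  obtain ⟨-, -, -, herr⟩ := h
  set v := s.b + μ • (s.y - x₀)
  have h2 : ‖s.y - u‖ ≤ σ * ‖s.y - x‖ + ‖x - lam • v - u‖ := by
    have h3 := norm_add_le (lam • v + s.y - x) (x - lam • v - u)
    rw [show lam • v + s.y - x + (x - lam • v - u) = s.y - u by abel] at h3
    linarith
  rw [div_mul_eq_mul_div, le_div_iff₀ hR, one_mul]
  refine le_of_sq_le_sq ?_ (norm_nonneg _)
  rw [mul_pow, Real.sq_sqrt hQ.le]
  have h3 : 0 ≤ 2 * lam * μ * ‖s.y - u‖ ^ 2 := by positivity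
  have h4 : ‖s.y - u‖ ^ 2 ≤ (σ * ‖s.y - x‖ + ‖x - lam • v - u‖) ^ 2 := by gcongr
  -- This square is exactly the defect in `(1 - σ²)(σα + β)² ≤ (1 - σ²)α² + β²`.
  nlinarith [sq_nonneg ((1 - σ ^ 2) * ‖s.y - x‖ - σ * ‖x - lam • v - u‖),
    mul_le_mul_of_nonneg_left h4 hQ.le]

end Step

/-! ### Iteration counts of the inner and outer loops. -/

section Complexity

variable {X : Type*} [NormedAddCommGroup X] [InnerProductSpace ℝ X]

/-- A step that contracts the distance to `u` and whose residual is controlled by this distance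
is executed only finitely often. -/
theorem Algorithm2.exists_and_le {step1 : X → StepOutput X → Prop} {x₀ u : X} {μ ρ ε a q : ℝ}
    (hρ : 0 ≤ ρ) (htot : ∀ x, ∃ s, step1 x s) (heps : ∀ x s, step1 x s → s.eps ≤ ε)
    (hq : 0 ≤ q)
    (hres : ∀ x s, step1 x s → ‖s.b + μ • (s.y - x₀)‖ ≤ a * ‖x - u‖)
    (hcontr : ∀ x s, step1 x s →
      ‖x - s.lam • (s.b + μ • (s.y - x₀)) - u‖ ^ 2 ≤ q * ‖x - u‖ ^ 2) (N : ℕ) :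
    ∀ x, q ^ N * (a * ‖x - u‖) ^ 2 ≤ ρ ^ 2 →
      (∃ n r, Algorithm2 step1 x₀ μ ρ ε x n r) ∧
        ∀ n r, Algorithm2 step1 x₀ μ ρ ε x n r → n ≤ N + 1 := by
  induction N with
  | zero =>
    intro x hx
    rw [pow_zero, one_mul] at hx
    have hle : ∀ s, step1 x s → ‖s.b + μ • (s.y - x₀)‖ ≤ ρ := fun s hs =>
      (hres x s hs).trans (le_of_sq_le_sq hx hρ)
    refine ⟨?_, ?_⟩
    · obtain ⟨s, hs⟩ := htot x
      exact ⟨1, s, .halt hs (hle s hs) (heps x s hs)⟩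
    · rintro _ _ (⟨hs, -, -⟩ | ⟨hs, hc, -⟩)
      · exact le_rfl
      · rcases hc with hc | hc
        · exact absurd (hle _ hs) hc.not_ge
        · exact absurd (heps _ _ hs) hc.not_ge
  | succ N ih =>
    intro x hx
    have hnext : ∀ s, step1 x s →
        q ^ N * (a * ‖x - s.lam • (s.b + μ • (s.y - x₀)) - u‖) ^ 2 ≤ ρ ^ 2 := fun s hs => by
      refine le_trans ?_ hx
      calc q ^ N * (a * ‖x - s.lam • (s.b + μ • (s.y - x₀)) - u‖) ^ 2
          = q ^ N * a ^ 2 * ‖x - s.lam • (s.b + μ • (s.y - x₀)) - u‖ ^ 2 := by ring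
        _ ≤ q ^ N * a ^ 2 * (q * ‖x - u‖ ^ 2) := by gcongr; exact hcontr x s hs
        _ = q ^ (N + 1) * (a * ‖x - u‖) ^ 2 := by ring
    refine ⟨?_, ?_⟩
    · obtain ⟨s, hs⟩ := htot x
      by_cases hb : ‖s.b + μ • (s.y - x₀)‖ ≤ ρ
      · exact ⟨1, s, .halt hs hb (heps x s hs)⟩
      · obtain ⟨n, r, hr⟩ := (ih _ (hnext s hs)).1
        exact ⟨n + 1, r, .step hs (.inl (not_le.1 hb)) hr⟩
    · rintro _ _ (⟨hs, -, -⟩ | ⟨hs, -, hr⟩)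
      · omega
      · have := (ih _ (hnext _ hs)).2 _ _ hr
        omega

theorem Algorithm2.output_spec {x₀ u x : X} {lam σ μ ρ ε : ℝ} {B : X → Set X}
    {step1 : X → StepOutput X → Prop} (hB : IsMonotoneOp B) (hlam : 0 < lam) (hμ : 0 < μ)
    (hσ : 0 < σ) (hσ1 : σ < 1) (hu : -(μ • (u - x₀)) ∈ B u)
    (hstep : ∀ x s, step1 x s → IsHPEStep x₀ lam σ μ B x s) {n : ℕ} {r : StepOutput X}
    (h : Algorithm2 step1 x₀ μ ρ ε x n r) :
    r.b ∈ B r.y ∧ ‖r.b + μ • (r.y - x₀)‖ ≤ ρ ∧ ‖r.y - u‖ ≤ 1 / √(1 - σ ^ 2) * ‖x - u‖ := by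
  induction h with
  | halt hs hb _ =>
    exact ⟨(hstep _ _ hs).2.2.1, hb, (hstep _ _ hs).norm_sub_le hB hlam hμ hσ hσ1 hu⟩
  | @step x s r n hs _ _ ih =>
    refine ⟨ih.1, ih.2.1, ih.2.2.trans ?_⟩
    have h1 := (hstep _ _ hs).fejer hB hlam hu
    rw [(hstep _ _ hs).1]
    gcongr
    refine le_of_sq_le_sq ?_ (norm_nonneg _)
    have hQ : 0 < 1 - σ ^ 2 := by nlinarith
    have h2 : 0 ≤ 2 * lam * μ * ‖s.y - u‖ ^ 2 := by positivity
    have h3 : 0 ≤ (1 - σ ^ 2) * ‖s.y - x‖ ^ 2 := by positivity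
    linarith

theorem exists_pow_mul_sq_le_one {θ T : ℝ} (hθ : 0 < θ) (hθ1 : θ ≤ 1) (hT : 0 ≤ T) :
    ∃ N : ℕ, (1 - θ) ^ N * T ^ 2 ≤ 1 ∧ (N : ℝ) ≤ 2 * log⁺ T / θ + 1 := by
  have h0 : 0 ≤ 2 * log⁺ T / θ := div_nonneg (mul_nonneg zero_le_two posLog_nonneg) hθ.le
  refine ⟨⌈2 * log⁺ T / θ⌉₊, ?_, (Nat.ceil_lt_add_one h0).le⟩
  have hN := Nat.le_ceil (2 * log⁺ T / θ)
  set N := ⌈2 * log⁺ T / θ⌉₊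
  rcases hT.eq_or_lt with rfl | hT
  · simp
  have h1 : (1 - θ) ^ N ≤ Real.exp (-(N * θ)) := by
    rw [← mul_neg, Real.exp_nat_mul]
    exact pow_le_pow_left₀ (by linarith) (Real.one_sub_le_exp_neg θ) N
  have h2 : T ^ 2 ≤ Real.exp (N * θ) := by
    rw [div_le_iff₀ hθ] at hN
    have h3 : Real.log T ≤ log⁺ T := le_max_right _ _
    calc T ^ 2 = Real.exp (2 * Real.log T) := by
          rw [two_mul, Real.exp_add, Real.exp_log hT, sq]
      _ ≤ Real.exp (N * θ) := Real.exp_le_exp.2 (by linarith)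
  calc (1 - θ) ^ N * T ^ 2 ≤ Real.exp (-(N * θ)) * Real.exp (N * θ) := by gcongr
    _ = 1 := by rw [← Real.exp_add, neg_add_cancel, Real.exp_zero]

/-- Existence of a result, and properties of every result, of one call of the inner method. -/
theorem algorithm2_complexity {x₀ u : X} {lam σ μ ρ ε d : ℝ} {B : X → Set X}
    {step1 : X → StepOutput X → Prop} (hB : IsMonotoneOp B) (hlam : 0 < lam) (hμ : 0 < μ)
    (hσ : 0 < σ) (hσ1 : σ < 1) (hρ : 0 < ρ) (hε : 0 ≤ ε) (hu : -(μ • (u - x₀)) ∈ B u)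
    (hd : ‖u - x₀‖ ≤ d) (htot : ∀ x, ∃ s, step1 x s)
    (hstep : ∀ x s, step1 x s → IsHPEStep x₀ lam σ μ B x s)
    (hμσ : 2 * lam * μ ≤ 1 - σ ^ 2) :
    (∃ n r, Algorithm2 step1 x₀ μ ρ ε x₀ n r) ∧
      ∀ n r, Algorithm2 step1 x₀ μ ρ ε x₀ n r →
        r.b ∈ B r.y ∧ ‖r.b + μ • (r.y - x₀)‖ ≤ ρ ∧ ‖r.y - x₀‖ ≤ (1 + 1 / √(1 - σ ^ 2)) * d ∧
        (n : ℝ) ≤ 1 / (lam * μ) *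
          (1 + 2 * log⁺ ((1 + σ) / (lam * √(1 - σ ^ 2)) * d / ρ)) := by
  have hQ : 0 < 1 - σ ^ 2 := by nlinarith
  have hQ1 : 1 - σ ^ 2 ≤ 1 := by nlinarith
  have hR : 0 < √(1 - σ ^ 2) := Real.sqrt_pos.2 hQ
  have hP : 0 < 2 * lam * μ := by positivity
  have hd0 : 0 ≤ d := (norm_nonneg _).trans hd
  set a := (1 + σ) / (lam * √(1 - σ ^ 2)) with ha
  have ha0 : 0 ≤ a := by positivity
  set θ := 2 * lam * μ * (1 - σ ^ 2) / (2 * lam * μ + (1 - σ ^ 2)) with hθ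
  have hθ0 : 0 < θ := by positivity
  have hθ1 : θ ≤ 1 := by
    rw [hθ, div_le_one (by positivity)]
    nlinarith
  -- With `2λμ ≤ 1 - σ²`, the harmonic-type mean `θ` is at least half of `2λμ`.
  have hθP : 1 / θ ≤ 1 / (lam * μ) := by
    rw [hθ, one_div_div, div_le_div_iff₀ (by positivity) (by positivity)]
    nlinarith [mul_pos hlam hμ]
  obtain ⟨N, hN1, hN2⟩ := exists_pow_mul_sq_le_one hθ0 hθ1 (T := a * d / ρ) (by positivity)
  have hux : ‖x₀ - u‖ ≤ d := by rwa [norm_sub_rev]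
  have hstart : (1 - θ) ^ N * (a * ‖x₀ - u‖) ^ 2 ≤ ρ ^ 2 := by
    rw [div_pow, mul_div_assoc', div_le_one (by positivity)] at hN1
    refine le_trans ?_ hN1
    have : 0 ≤ 1 - θ := by linarith
    gcongr
  obtain ⟨hex, hle⟩ := Algorithm2.exists_and_le (ε := ε) hρ.le htot
    (fun x s hs => by rw [(hstep x s hs).2.1]; exact hε) (sub_nonneg.2 hθ1)
    (fun x s hs => (hstep x s hs).norm_residual_le hB hlam hμ hσ hσ1 hu)
    (fun x s hs => by
      rw [(hstep x s hs).1]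
      exact (hstep x s hs).contraction hB hlam hμ hσ hσ1 hu) N x₀ hstart
  refine ⟨hex, fun n r h => ?_⟩
  obtain ⟨h1, h2, h3⟩ := h.output_spec hB hlam hμ hσ hσ1 hu hstep
  refine ⟨h1, h2, ?_, ?_⟩
  · calc ‖r.y - x₀‖ ≤ ‖r.y - u‖ + ‖u - x₀‖ := norm_sub_le_norm_sub_add_norm_sub _ _ _
      _ ≤ 1 / √(1 - σ ^ 2) * d + d := by
        gcongr
        exact h3.trans (by gcongr)
      _ = (1 + 1 / √(1 - σ ^ 2)) * d := by ring
  · have h4 : (n : ℝ) ≤ N + 1 := mod_cast hle n r h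
    have h5 : 0 ≤ log⁺ (a * d / ρ) := posLog_nonneg
    have h6 : 2 * log⁺ (a * d / ρ) / θ ≤ 1 / (lam * μ) * (2 * log⁺ (a * d / ρ)) := by
      rw [div_eq_mul_one_div, mul_comm]
      gcongr
    -- Absorbs two extra units: one from rounding up `N`, one from the final iteration.
    have h7 : 2 ≤ 1 / (lam * μ) := by
      rw [le_div_iff₀ (by positivity)]
      linarith
    linarith

/-- Existence of a result, and properties of every result, of the outer loop, given those of the
calls of the inner method. -/
theorem drhpeLoop_complexity {step1 : ℝ → X → StepOutput X → Prop} {x₀ : X}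
    {σ ρ ρbar εbar d D₀ E : ℝ} {B : X → Set X} (hρ : ρ < ρbar) (hE : 0 ≤ E) (hD₀ : 0 < D₀)
    (hinner : ∀ D, D₀ ≤ D →
      (∃ n r, Algorithm2 (step1 (regParam σ ρbar ρ D)) x₀ (regParam σ ρbar ρ D) ρ εbar x₀ n r) ∧
      ∀ n r, Algorithm2 (step1 (regParam σ ρbar ρ D)) x₀ (regParam σ ρbar ρ D) ρ εbar x₀ n r →
        r.b ∈ B r.y ∧ ‖r.b + regParam σ ρbar ρ D • (r.y - x₀)‖ ≤ ρ ∧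
        ‖r.y - x₀‖ ≤ (1 + 1 / √(1 - σ ^ 2)) * d ∧ (n : ℝ) ≤ E * D) :
    (∃ n r, DRHPELoop step1 x₀ σ ρbar εbar ρ D₀ n r) ∧
      ∀ n r, DRHPELoop step1 x₀ σ ρbar εbar ρ D₀ n r →
        r.b ∈ B r.y ∧ ‖r.b‖ ≤ ρbar ∧ (n : ℝ) ≤ E * (D₀ + 4 * d) := by
  have hg : 0 < 1 + 1 / √(1 - σ ^ 2) := by positivity
  have hρ' : 0 < ρbar - ρ := sub_pos.2 hρ
  have hμ : ∀ D, D₀ ≤ D → 0 < regParam σ ρbar ρ D := fun D hD =>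
    div_pos hρ' (mul_pos hg (hD₀.trans_le hD))
  -- A rejected guess is below `d`: the factor `1 + 1 / √(1 - σ ^ 2)` in `regParam` cancels the one
  -- in the bound on `‖r.y - x₀‖`.
  have hlt : ∀ D, D₀ ≤ D → ∀ n r,
      Algorithm2 (step1 (regParam σ ρbar ρ D)) x₀ (regParam σ ρbar ρ D) ρ εbar x₀ n r →
      ρbar - ρ < regParam σ ρbar ρ D * ‖r.y - x₀‖ → D < d := by
    intro D hD n r hr h
    have hD0 : 0 < D := hD₀.trans_le hD
    have h1 := ((hinner D hD).2 n r hr).2.2.1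
    have h2 := h.trans_le (mul_le_mul_of_nonneg_left h1 (hμ D hD).le)
    rw [regParam, div_mul_eq_mul_div, lt_div_iff₀ (by positivity)] at h2
    exact lt_of_mul_lt_mul_left (lt_of_mul_lt_mul_left h2 hρ'.le) hg.le
  constructor
  · have key : ∀ k : ℕ, ∀ D, D₀ ≤ D → d ≤ 2 ^ k * D →
        ∃ n r, DRHPELoop step1 x₀ σ ρbar εbar ρ D n r := by
      intro k
      induction k with
      | zero =>
        intro D hD hd
        obtain ⟨n, r, hr⟩ := (hinner D hD).1
        refine ⟨n, r, .halt hr (not_lt.1 fun h => ?_)⟩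
        have := hlt D hD n r hr h
        rw [pow_zero, one_mul] at hd
        exact this.not_ge hd
      | succ k ih =>
        intro D hD hd
        obtain ⟨n, r, hr⟩ := (hinner D hD).1
        by_cases hy : regParam σ ρbar ρ D * ‖r.y - x₀‖ ≤ ρbar - ρ
        · exact ⟨n, r, .halt hr hy⟩
        · obtain ⟨m, r', hr'⟩ := ih (2 * D) (by linarith) (by rw [pow_succ] at hd; linarith)
          exact ⟨n + m, r', .step hr (not_le.1 hy) hr'⟩
    obtain ⟨k, hk⟩ := pow_unbounded_of_one_lt (d / D₀) one_lt_two
    exact key k D₀ le_rfl ((div_le_iff₀ hD₀).1 hk.le)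
  -- The potential `max D (4 * d - D)` survives doubling: for `D < d`, `D + max (2D) (4d - 2D) ≤ 4d
  -- - D`.
  · have key : ∀ D n r, DRHPELoop step1 x₀ σ ρbar εbar ρ D n r → D₀ ≤ D →
        r.b ∈ B r.y ∧ ‖r.b‖ ≤ ρbar ∧ (n : ℝ) ≤ E * max D (4 * d - D) := by
      intro D n r h
      induction h with
      | @halt D n s hs hy =>
        intro hD
        obtain ⟨h1, h2, -, h4⟩ := (hinner D hD).2 _ _ hs
        refine ⟨h1, ?_, h4.trans (mul_le_mul_of_nonneg_left (le_max_left _ _) hE)⟩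
        have h5 := norm_sub_le (s.b + regParam σ ρbar ρ D • (s.y - x₀))
          (regParam σ ρbar ρ D • (s.y - x₀))
        rw [add_sub_cancel_right, norm_smul (regParam σ ρbar ρ D) (s.y - x₀),
          Real.norm_of_nonneg (hμ D hD).le] at h5
        linarith
      | @step D n m s r hs hy _ ih =>
        intro hD
        obtain ⟨h1, h2, h3⟩ := ih (by linarith)
        have h4 := ((hinner D hD).2 _ _ hs).2.2.2
        have h5 := hlt D hD _ _ hs hy
        refine ⟨h1, h2, ?_⟩
        push_cast
        calc (n : ℝ) + m ≤ E * D + E * max (2 * D) (4 * d - 2 * D) := add_le_add h4 h3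
          _ = E * (D + max (2 * D) (4 * d - 2 * D)) := by ring
          _ ≤ E * max D (4 * d - D) := by
            gcongr
            refine le_trans ?_ (le_max_right _ _)
            rw [← le_sub_iff_add_le']
            exact max_le (by linarith) (by linarith)
    intro n r h
    have hd : 0 ≤ d := by
      obtain ⟨n, r, hr⟩ := (hinner D₀ le_rfl).1
      exact nonneg_of_mul_nonneg_right
        ((norm_nonneg _).trans ((hinner D₀ le_rfl).2 n r hr).2.2.1) hg
    obtain ⟨h1, h2, h3⟩ := key _ n r h le_rfl
    refine ⟨h1, h2, h3.trans ?_⟩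
    gcongr
    exact max_le (by linarith) (by linarith)

theorem one_div_one_sub_sq_le {σ N : ℝ} (hσ : 0 < σ) (hσ1 : σ < 1) (h : (1 - σ)⁻¹ ≤ N) :
    1 / (1 - σ ^ 2) ≤ N := by
  refine le_trans ?_ h
  rw [← one_div]
  exact one_div_le_one_div_of_le (by linarith) (by nlinarith)

theorem one_div_sqrt_one_sub_sq_le {σ N : ℝ} (hσ : 0 < σ) (hσ1 : σ < 1) (h : (1 - σ)⁻¹ ≤ N) :
    1 / √(1 - σ ^ 2) ≤ N := by
  refine le_trans ?_ h
  rw [← one_div]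
  refine one_div_le_one_div_of_le (by linarith) ?_
  exact Real.le_sqrt_of_sq_le (by nlinarith)

end Complexity

/-! ### Assembling the constants. -/

theorem theorem4p2 (M : ℝ) :
    ∃ K : ℝ, 0 < K ∧
      ∀ (X : Type*) [NormedAddCommGroup X] [InnerProductSpace ℝ X] [FiniteDimensional ℝ X]
        (F : X → X) (C : X → Set X) (Ω : Set X) (L : ℝ) (x₀ : X) (σ ρ ρbar εbar : ℝ),
        (∀ x ∈ opDom C, ∀ x' ∈ opDom C, 0 ≤ inner ℝ (F x - F x') (x - x')) →
        IsClosed Ω → Convex ℝ Ω → opDom C ⊆ Ω →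
        0 < L → (∀ x ∈ Ω, ∀ x' ∈ Ω, ‖F x - F x'‖ ≤ L * ‖x - x'‖) →
        IsMaximalMonotoneOp C →
        (zeroSet (sumOp F C)).Nonempty →
        0 < σ → σ < 1 → max σ⁻¹ (1 - σ)⁻¹ ≤ M →
        0 < ρ → ρ < ρbar → 0 < εbar →
        -- step 1 is well defined: it can always be carried out, with a unique result
        (∀ μ : ℝ, 0 < μ → ∀ x : X, ∃! s : StepOutput X, TsengStep F C Ω x₀ (σ / L) μ x s) ∧
        -- the method terminates
        (∃ (n : ℕ) (r : StepOutput X),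
          DRHPE (TsengStep F C Ω x₀ (σ / L)) x₀ σ (σ / L) ρbar εbar ρ n r) ∧
        -- its output and its number of inner iterations are as claimed
        (∀ (n : ℕ) (r : StepOutput X),
          DRHPE (TsengStep F C Ω x₀ (σ / L)) x₀ σ (σ / L) ρbar εbar ρ n r →
          r.b ∈ sumOp F C r.y ∧ ‖r.b‖ ≤ ρbar ∧
          (n : ℝ) ≤ K * ((1 + L * Metric.infDist x₀ (zeroSet (sumOp F C)) / (ρbar - ρ)) *
            (1 + log⁺ (L * Metric.infDist x₀ (zeroSet (sumOp F C)) / ρ)))) := by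
  -- The first factor absorbs the logarithm's constants, the second those of `D₀ + 4d`. Using `max M
  -- 1` keeps `K` positive for every `M` and lets `N` be bounded by `N ^ 2`.
  refine ⟨(1 + 4 * max M 1 ^ 2) * (8 * max M 1 ^ 2), by positivity, ?_⟩
  intro X _ _ _ F C Ω L x₀ σ ρ ρbar εbar hF hcl hcv hdom hL hLip hC hzero hσ hσ1 hM hρ hρbar hεbar
  have hN1 : 1 ≤ max M 1 := le_max_right _ _
  have hNσ : σ⁻¹ ≤ max M 1 := (le_max_left _ _).trans (hM.trans (le_max_left _ _))
  have hNσ' : (1 - σ)⁻¹ ≤ max M 1 := (le_max_right _ _).trans (hM.trans (le_max_left _ _))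
  set N := max M 1
  have hlam : 0 < σ / L := by positivity
  have hne : Ω.Nonempty := hzero.imp fun x hx => hdom (mem_opDom_of_mem_sumOp hx)
  have hB := hC.1.sumOp hF
  obtain ⟨z, hz, hzd⟩ := exists_norm_sub_eq_infDist_zeroSet hcl hdom hLip hC hzero x₀
  have hd0 : 0 ≤ Metric.infDist x₀ (zeroSet (sumOp F C)) := Metric.infDist_nonneg
  set d := Metric.infDist x₀ (zeroSet (sumOp F C))
  have huniq : ∀ μ : ℝ, 0 < μ → ∀ x : X, ∃! s : StepOutput X, TsengStep F C Ω x₀ (σ / L) μ x s :=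
    fun μ hμ x => existsUnique_tsengStep hcl hcv hne hC x₀ hlam hμ x
  have hQ : 0 < 1 - σ ^ 2 := by nlinarith
  have hR : 0 < √(1 - σ ^ 2) := Real.sqrt_pos.2 hQ
  have hρ' : 0 < ρbar - ρ := sub_pos.2 hρbar
  have hRN := one_div_sqrt_one_sub_sq_le hσ hσ1 hNσ'
  have hQN := one_div_one_sub_sq_le hσ hσ1 hNσ'
  set g := 1 + 1 / √(1 - σ ^ 2) with hg
  have hg0 : 0 < g := by positivity
  set l := log⁺ (L * d / ρ) with hl
  have hl0 : 0 ≤ l := posLog_nonneg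
  have hlog : 1 + 2 * log⁺ ((1 + σ) / (σ / L * √(1 - σ ^ 2)) * d / ρ)
      ≤ (1 + 4 * N ^ 2) * (1 + l) := by
    set κ := (1 + σ) * (σ⁻¹ * (1 / √(1 - σ ^ 2))) with hκ
    have h1 : (1 + σ) / (σ / L * √(1 - σ ^ 2)) * d / ρ = κ * (L * d / ρ) := by
      rw [hκ]
      field_simp
    have hκ0 : 0 ≤ κ := by positivity
    have h2 : κ ≤ 2 * (N * N) := by
      rw [hκ]
      gcongr
      linarith
    have h3 : log⁺ κ ≤ κ := max_le hκ0 (Real.log_le_self hκ0)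
    have h4 : log⁺ (κ * (L * d / ρ)) ≤ log⁺ κ + l := posLog_mul
    rw [h1]
    nlinarith [mul_nonneg (sub_nonneg.2 hN1) hl0, mul_nonneg (sq_nonneg (N - 1)) hl0]
  have hinit : initialGuess σ (σ / L) ρbar ρ = 2 * (σ / L) * (ρbar - ρ) / ((1 - σ ^ 2) * g) := rfl
  have hD₀ : 0 < initialGuess σ (σ / L) ρbar ρ := by
    rw [hinit]
    positivity
  set E := g / (σ / L * (ρbar - ρ)) * ((1 + 4 * N ^ 2) * (1 + l)) with hE
  have hE0 : 0 ≤ E := by positivity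
  obtain ⟨hex, hall⟩ := drhpeLoop_complexity (step1 := TsengStep F C Ω x₀ (σ / L)) (x₀ := x₀)
    (σ := σ) (εbar := εbar) (d := d) (B := sumOp F C) hρbar hE0 hD₀ (fun D hD => by
      have hD0 : 0 < D := hD₀.trans_le hD
      have hμeq : regParam σ ρbar ρ D = (ρbar - ρ) / (g * D) := rfl
      have hμ : 0 < regParam σ ρbar ρ D := by
        rw [hμeq]
        positivity
      obtain ⟨u, hu⟩ := exists_regularized_zero hF hcl hcv hdom hL hLip hC hne x₀ hμ
      have hud : ‖u - x₀‖ ≤ d := hzd ▸ norm_regularized_zero_sub_le hB hμ hu hz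
      -- The initial guess is the value of `D` giving equality here; larger `D` only decreases `μ`.
      have hμσ : 2 * (σ / L) * regParam σ ρbar ρ D ≤ 1 - σ ^ 2 := by
        rw [hinit, div_le_iff₀ (by positivity)] at hD
        rw [hμeq, mul_div_assoc', div_le_iff₀ (by positivity)]
        linarith
      obtain ⟨h1, h2⟩ := algorithm2_complexity (ρ := ρ) (ε := εbar) hB hlam hμ hσ hσ1 hρ hεbar.le
        hu hud (fun x => (huniq _ hμ x).exists)
        (fun x s hs => hs.isHPEStep hdom hL hLip hσ) hμσ
      refine ⟨h1, fun n r h => ?_⟩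
      obtain ⟨h3, h4, h5, h6⟩ := h2 n r h
      refine ⟨h3, h4, h5, h6.trans ?_⟩
      calc 1 / (σ / L * regParam σ ρbar ρ D) *
            (1 + 2 * log⁺ ((1 + σ) / (σ / L * √(1 - σ ^ 2)) * d / ρ))
          ≤ 1 / (σ / L * regParam σ ρbar ρ D) * ((1 + 4 * N ^ 2) * (1 + l)) := by gcongr
        _ = E * D := by
          rw [hE, hμeq]
          field_simp)
  refine ⟨huniq, hex, fun n r h => ?_⟩
  obtain ⟨h1, h2, h3⟩ := hall n r h
  refine ⟨h1, h2, h3.trans ?_⟩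
  have h4 : E * (initialGuess σ (σ / L) ρbar ρ + 4 * d)
      = (1 + 4 * N ^ 2) * (2 * (1 / (1 - σ ^ 2)) + 4 * (σ⁻¹ * g) * (L * d / (ρbar - ρ)))
        * (1 + l) := by
    rw [hE, hinit]
    field_simp
  have h5 : σ⁻¹ * g ≤ N * (2 * N) := by
    gcongr
    linarith
  have h6 : 0 ≤ L * d / (ρbar - ρ) := by positivity
  have h7 : 2 * (1 / (1 - σ ^ 2)) + 4 * (σ⁻¹ * g) * (L * d / (ρbar - ρ))
      ≤ 8 * N ^ 2 * (1 + L * d / (ρbar - ρ)) :=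
    calc 2 * (1 / (1 - σ ^ 2)) + 4 * (σ⁻¹ * g) * (L * d / (ρbar - ρ))
        ≤ 2 * N + 4 * (N * (2 * N)) * (L * d / (ρbar - ρ)) := by gcongr
      _ ≤ 8 * N ^ 2 * (1 + L * d / (ρbar - ρ)) := by nlinarith
  calc _ ≤ (1 + 4 * N ^ 2) * (8 * N ^ 2 * (1 + L * d / (ρbar - ρ))) * (1 + l) := by
        rw [h4]
        gcongr
    _ = _ := by ring
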